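/- For integers $1\le k\le n$ let $St(n,k)$ be the real Stiefel manifold of orthonormal $k$-tuples $(v_1,\dots,v_k)$ in $\mathbb{R}^n$, with the free involution $S(v_1,\dots,v_k)=(v_1,\dots,v_{k-1},-v_k)$. For a compact Hausdorff space $X$ with a fixed-point free involution $T$, and with $S^m$ carrying the antipodal map, define the Conner–Floyd index $$\mathrm{ind}(X,T)=\max\{m\ge 0 : \text{there is a continuous equivariant map } S^m\to X\}$$ and the coindex $$\mathrm{coind}(X,T)=\min\{m\ge 0 : \text{there is a continuous equivariant map } X\to S^m\},$$ both taken in $\mathbb{N}\cup\{\infty\}$. The Yang index $\nu(X,T)$ is the largest $m$ (in $\mathbb{N}\cup\{\infty\}$) such that the index homomorphism $\nu:H_m(X,T)\to\mathbb{Z}_2$ is nonzero. Here $H_m(X,T)$ is the Čech–Smith $T$-homology with $\mathbb{Z}_2$ coefficients: the inverse limit, over finite $T$-invariant open covers no member of which meets its image under $T$, of the homology of the $T$-invariant simplicial chains of the nerves. The index of an invariant cycle $c=d+T(d)$ is the number of vertices in $d$ modulo $2$ in dimension $0$, and the index of $\partial d$ in positive dimension. **Proposition 4.1 (Stiefel monotonicity).**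 Let $1\le k\le n$. Then the following hold. (a) For each $n$, the Conner–Floyd index, the Yang index and the coindex of $St(n,k)$ are nonincreasing in $k$ (for $1\le k\le n$). (b) For each $k$, the Conner–Floyd index, the Yang index and the coindex of $St(n,k)$ are nondecreasing in $n$ (for $n\ge k$). (c) For each $n$ and $k$, the Conner–Floyd index, the Yang index and the coindex of $St(n+\ell,k+\ell)$ are nondecreasing in $\ell\ge 0$. -/

import Mathlib

/-! Spaces with a free involution, their `ℤ/2`-equivariant (Čech–Smith) homology, the Yang index,
the Conner–Floyd index and coindex, and the real Stiefel manifolds. -/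

namespace ZTwo

/-! ### Simplicial chains with coefficients in `ℤ/2` -/

section Chains

variable {ι κ : Type*} [DecidableEq ι] [DecidableEq κ]

/-- Formal sums with `ℤ/2`-coefficients of finite subsets of the vertex set `ι`.  The `m`-chains of
a complex are the sums of its faces with `m + 1` vertices, see `FreeComplex.chains`. -/
abbrev Chain (ι : Type*) : Type _ := Finset ι →₀ ZMod 2

/-- The sum of all the codimension one faces (for a vertex this is the empty set). -/
noncomputable def boundaryAux : Chain ι →+ Chain ι :=
  (Finsupp.linearCombination (ZMod 2)
    fun s : Finset ι => ∑ v ∈ s, Finsupp.single (s.erase v) (1 : ZMod 2)).toAddMonoidHom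

/-- The boundary `∂ₘ` on `m`-chains; `∂₀ = 0`. -/
noncomputable def boundary : ℕ → (Chain ι →+ Chain ι)
  | 0 => 0
  | _ + 1 => boundaryAux

/-- The map on chains induced by a map of vertices; simplices on which the map of vertices is not
injective are sent to zero. -/
noncomputable def push (f : ι → κ) : Chain ι →+ Chain κ :=
  (Finsupp.linearCombination (ZMod 2) fun s : Finset ι =>
    if (s.image f).card = s.card then Finsupp.single (s.image f) (1 : ZMod 2)
    else 0).toAddMonoidHom

/-- The number of simplices in a chain, modulo two. -/
noncomputable def parity : Chain ι →+ ZMod 2 :=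
  (Finsupp.linearCombination (ZMod 2) fun _ : Finset ι => (1 : ZMod 2)).toAddMonoidHom

theorem eq_zero_or_eq_one (a : ZMod 2) : a = 0 ∨ a = 1 := by
  revert a
  decide

theorem hom_ext {ι A : Type*} [AddCommGroup A] {f g : Chain ι →+ A}
    (h : ∀ s, f (Finsupp.single s 1) = g (Finsupp.single s 1)) : f = g := by
  refine Finsupp.addHom_ext fun s a => ?_
  rcases eq_zero_or_eq_one a with rfl | rfl
  · simp
  · exact h s

theorem parity_single {ι : Type*} (s : Finset ι) :
    parity (Finsupp.single s (1 : ZMod 2)) = 1 := by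
  simp [parity]

theorem boundaryAux_single (s : Finset ι) :
    boundaryAux (Finsupp.single s 1) = ∑ v ∈ s, Finsupp.single (s.erase v) (1 : ZMod 2) := by
  simp [boundaryAux]

theorem push_single {ι κ : Type*} [DecidableEq κ] (f : ι → κ) (s : Finset ι) :
    push f (Finsupp.single s 1) =
      if (s.image f).card = s.card then Finsupp.single (s.image f) (1 : ZMod 2) else 0 := by
  simp [push]

theorem push_single_of_card {ι κ : Type*} [DecidableEq κ] {f : ι → κ} {s : Finset ι} (h : (s.image f).card = s.card) :
    push f (Finsupp.single s 1) = Finsupp.single (s.image f) (1 : ZMod 2) := by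
  rw [push_single, if_pos h]

theorem push_single_of_card_ne {ι κ : Type*} [DecidableEq κ] {f : ι → κ} {s : Finset ι} (h : (s.image f).card ≠ s.card) :
    push f (Finsupp.single s (1 : ZMod 2)) = 0 := by
  rw [push_single, if_neg h]

theorem boundaryAux_push (f : ι → κ) (c : Chain ι) :
    boundaryAux (push f c) = push f (boundaryAux c) := by
  suffices h : boundaryAux.comp (push f) = (push f).comp boundaryAux from DFunLike.congr_fun h c
  refine hom_ext fun s => ?_
  simp only [AddMonoidHom.comp_apply]
  rw [boundaryAux_single, map_sum]
  by_cases hs : (s.image f).card = s.card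
  · have hinj := Finset.card_image_iff.1 hs
    rw [push_single_of_card hs, boundaryAux_single, Finset.sum_image hinj]
    refine Finset.sum_congr rfl fun v hv => ?_
    have himg : (s.erase v).image f = (s.image f).erase (f v) := by
      ext w
      simp only [Finset.mem_image, Finset.mem_erase]
      constructor
      · rintro ⟨a, ⟨hav, ha⟩, rfl⟩
        exact ⟨fun h => hav (hinj ha hv h), a, ha, rfl⟩
      · rintro ⟨hw, a, ha, rfl⟩
        exact ⟨a, ⟨fun h => hw (by rw [h]), ha⟩, rfl⟩
    rw [push_single_of_card, himg]
    exact Finset.card_image_iff.2 (hinj.mono (by simp))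
  · rw [push_single_of_card_ne hs, map_zero]
    have hninj : ¬ Set.InjOn f s := fun h => hs (Finset.card_image_iff.2 h)
    simp only [Set.InjOn, not_forall] at hninj
    obtain ⟨a, ha, b, hb, hab, hne⟩ := hninj
    have ha' : a ∈ s := ha
    have hb' : b ∈ s := hb
    have hzero : ∀ v ∈ s, v ∉ ({a, b} : Finset ι) →
        push f (Finsupp.single (s.erase v) (1 : ZMod 2)) = 0 := by
      intro v _ hv
      simp only [Finset.mem_insert, Finset.mem_singleton, not_or] at hv
      refine push_single_of_card_ne fun h => hne ?_
      exact Finset.card_image_iff.1 h (by simp [ha', Ne.symm hv.1]) (by simp [hb', Ne.symm hv.2])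
        hab
    have hsub : ({a, b} : Finset ι) ⊆ s := by
      intro x hx
      simp only [Finset.mem_insert, Finset.mem_singleton] at hx
      rcases hx with rfl | rfl <;> assumption
    rw [← Finset.sum_subset hsub hzero, Finset.sum_pair hne]
    have himg : (s.erase a).image f = (s.erase b).image f := by
      ext w
      simp only [Finset.mem_image, Finset.mem_erase]
      constructor
      · rintro ⟨x, ⟨hxa, hx⟩, rfl⟩
        by_cases hxb : x = b
        · exact ⟨a, ⟨hne, ha'⟩, by rw [hxb, hab]⟩
        · exact ⟨x, ⟨hxb, hx⟩, rfl⟩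
      · rintro ⟨x, ⟨hxb, hx⟩, rfl⟩
        by_cases hxa : x = a
        · exact ⟨b, ⟨Ne.symm hne, hb'⟩, by rw [hxa, hab]⟩
        · exact ⟨x, ⟨hxa, hx⟩, rfl⟩
    rw [push_single, push_single, himg, Finset.card_erase_of_mem ha', Finset.card_erase_of_mem hb']
    exact (ZModModule.add_self _).symm

theorem boundary_push (f : ι → κ) (m : ℕ) (c : Chain ι) :
    boundary m (push f c) = push f (boundary m c) := by
  cases m with
  | zero => simp [boundary]
  | succ m => exact boundaryAux_push f c

theorem boundaryAux_boundaryAux (c : Chain ι) : boundaryAux (boundaryAux c) = 0 := by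
  suffices h : boundaryAux.comp boundaryAux = (0 : Chain ι →+ Chain ι) from
    DFunLike.congr_fun h c
  refine hom_ext fun s => ?_
  simp only [AddMonoidHom.comp_apply, AddMonoidHom.zero_apply]
  rw [boundaryAux_single, map_sum]
  simp only [boundaryAux_single]
  rw [Finset.sum_sigma']
  refine Finset.sum_involution (fun p _ => ⟨p.2, p.1⟩) ?_ ?_ ?_ ?_
  · rintro ⟨v, w⟩ _
    simp only [Finset.erase_right_comm (a := v) (b := w)]
    exact ZModModule.add_self _
  · rintro ⟨v, w⟩ h _ heq
    simp only [Finset.mem_sigma, Finset.mem_erase] at h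
    simp only [Sigma.mk.injEq, heq_eq_eq] at heq
    exact h.2.1 heq.1
  · rintro ⟨v, w⟩ h
    simp only [Finset.mem_sigma, Finset.mem_erase] at h ⊢
    exact ⟨h.2.2, Ne.symm h.2.1, h.1⟩
  · rintro ⟨v, w⟩ _
    rfl

theorem boundary_boundary (m : ℕ) (c : Chain ι) : boundary m (boundary (m + 1) c) = 0 := by
  cases m with
  | zero => simp [boundary]
  | succ m => exact boundaryAux_boundaryAux c

theorem push_comp {ι κ ξ : Type*} [DecidableEq κ] [DecidableEq ξ] (g : κ → ξ) (f : ι → κ) (c : Chain ι) :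
    push g (push f c) = push (g ∘ f) c := by
  suffices h : (push g).comp (push f) = push (g ∘ f) from DFunLike.congr_fun h c
  refine hom_ext fun s => ?_
  simp only [AddMonoidHom.comp_apply]
  by_cases hs : (s.image f).card = s.card
  · rw [push_single_of_card hs, push_single, push_single, Finset.image_image, hs]
  · rw [push_single_of_card_ne hs, map_zero, push_single_of_card_ne]
    intro h
    apply hs
    rw [← Finset.image_image] at h
    exact le_antisymm Finset.card_image_le (h ▸ Finset.card_image_le)

theorem push_id (c : Chain ι) : push id c = c := by
  suffices h : push id = AddMonoidHom.id (Chain ι) from DFunLike.congr_fun h c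
  refine hom_ext fun s => ?_
  simp [push_single]

end Chains

/-! ### Simplicial complexes with a free involution -/

/-- An abstract simplicial complex on the vertex set `ι` with a simplicial involution that maps no
simplex to itself; equivalently, the involution of the geometric realization has no fixed point. -/
structure FreeComplex (ι : Type*) [DecidableEq ι] extends PreAbstractSimplicialComplex ι where
  invol : ι → ι
  invol_invol : ∀ i, invol (invol i) = i
  image_mem : ∀ s ∈ faces, s.image invol ∈ faces
  image_ne : ∀ s ∈ faces, s.image invol ≠ s

namespace FreeComplex

variable {ι κ ξ : Type*} [DecidableEq ι] [DecidableEq κ] [DecidableEq ξ]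

/-- The action of the involution on chains. -/
noncomputable def act (K : FreeComplex ι) : Chain ι →+ Chain ι := push K.invol

/-- The `m`-chains of `K`. -/
def chains (K : FreeComplex ι) (m : ℕ) : AddSubgroup (Chain ι) where
  carrier := {c | ∀ s, c s ≠ 0 → s ∈ K.faces ∧ s.card = m + 1}
  zero_mem' := fun s hs => absurd rfl hs
  add_mem' := by
    intro c d hc hd s hs
    by_cases h : c s = 0
    · refine hd s fun h' => hs ?_
      rw [Finsupp.add_apply, h, h', add_zero]
    · exact hc s h
  neg_mem' := by
    intro c hc s hs
    refine hc s fun h => hs ?_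
    rw [Finsupp.neg_apply, h, neg_zero]

/-- The `m`-chains that are invariant under the involution. -/
noncomputable def invChains (K : FreeComplex ι) (m : ℕ) : AddSubgroup (Chain ι) :=
  K.chains m ⊓ AddMonoidHom.eqLocus K.act (AddMonoidHom.id _)

/-- The invariant `m`-cycles. -/
noncomputable def cycles (K : FreeComplex ι) (m : ℕ) : AddSubgroup (Chain ι) :=
  K.invChains m ⊓ (boundary m).ker

/-- The boundaries of invariant `(m+1)`-chains. -/
noncomputable def boundaries (K : FreeComplex ι) (m : ℕ) : AddSubgroup (Chain ι) :=
  (K.invChains (m + 1)).map (boundary (m + 1))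

/-- The `m`-th equivariant homology group: invariant cycles modulo boundaries of invariant
chains. -/
abbrev Homology (K : FreeComplex ι) (m : ℕ) : Type _ :=
  K.cycles m ⧸ (K.boundaries m).addSubgroupOf (K.cycles m)

open Classical in
/-- The index of an invariant chain `c = d + T d`: the parity of the number of vertices in `d` in
dimension zero, and the index of `∂ d` in positive dimension.  For invariant cycles the result does
not depend on the splitting, see `index_zero_eq` and `index_succ_eq`. -/
noncomputable def index (K : FreeComplex ι) : ℕ → Chain ι → ZMod 2
  | 0, c => if h : ∃ d ∈ K.chains 0, c = d + K.act d then parity h.choose else 0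
  | m + 1, c => if h : ∃ d ∈ K.chains (m + 1), c = d + K.act d then
      index K m (boundary (m + 1) h.choose) else 0

theorem act_act (K : FreeComplex ι) (c : Chain ι) : K.act (K.act c) = c := by
  have h : K.invol ∘ K.invol = id := funext K.invol_invol
  rw [act, push_comp, h, push_id]

theorem card_image (K : FreeComplex ι) (s : Finset ι) : (s.image K.invol).card = s.card :=
  Finset.card_image_of_injective _ (Function.Involutive.injective K.invol_invol)

theorem image_image (K : FreeComplex ι) (s : Finset ι) :
    (s.image K.invol).image K.invol = s := by
  have h : K.invol ∘ K.invol = id := funext K.invol_invol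
  rw [Finset.image_image, h, Finset.image_id]

theorem act_apply (K : FreeComplex ι) (c : Chain ι) (s : Finset ι) :
    K.act c s = c (s.image K.invol) := by
  suffices h : (Finsupp.applyAddHom s).comp K.act =
      (Finsupp.applyAddHom (s.image K.invol) : Chain ι →+ ZMod 2) from DFunLike.congr_fun h c
  refine hom_ext fun t => ?_
  simp only [AddMonoidHom.comp_apply, act,
    push_single_of_card (K.card_image t), Finsupp.applyAddHom_apply, Finsupp.single_apply]
  refine if_congr ⟨fun h => ?_, fun h => ?_⟩ rfl rfl
  · rw [← h, K.image_image]
  · rw [h, K.image_image]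

theorem mem_chains_iff (K : FreeComplex ι) {m : ℕ} {c : Chain ι} :
    c ∈ K.chains m ↔ ∀ s, c s ≠ 0 → s ∈ K.faces ∧ s.card = m + 1 := Iff.rfl

theorem single_mem_chains (K : FreeComplex ι) {m : ℕ} {s : Finset ι} (hs : s ∈ K.faces)
    (hcard : s.card = m + 1) : Finsupp.single s (1 : ZMod 2) ∈ K.chains m := by
  intro t ht
  rw [Finsupp.single_apply, ne_eq, ite_eq_right_iff, Classical.not_imp] at ht
  exact ht.1 ▸ ⟨hs, hcard⟩

/-- The `m`-chains are generated by the `m`-simplices. -/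
theorem chains_le (K : FreeComplex ι) {m : ℕ} {H : AddSubgroup (Chain ι)}
    (h : ∀ s ∈ K.faces, s.card = m + 1 → Finsupp.single s (1 : ZMod 2) ∈ H) : K.chains m ≤ H := by
  intro c hc
  rw [← Finsupp.sum_single c, Finsupp.sum]
  refine sum_mem fun s hs => ?_
  have hne := Finsupp.mem_support_iff.1 hs
  rw [(eq_zero_or_eq_one (c s)).resolve_left hne]
  exact h s (hc s hne).1 (hc s hne).2

theorem act_mem_chains (K : FreeComplex ι) {m : ℕ} {c : Chain ι} (hc : c ∈ K.chains m) :
    K.act c ∈ K.chains m := by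
  rw [mem_chains_iff] at hc ⊢
  intro s hs
  rw [act_apply] at hs
  obtain ⟨h1, h2⟩ := hc _ hs
  rw [K.card_image] at h2
  have h3 := K.image_mem _ h1
  rw [K.image_image] at h3
  exact ⟨h3, h2⟩

theorem boundary_mem_chains (K : FreeComplex ι) {m : ℕ} {c : Chain ι} (hc : c ∈ K.chains (m + 1)) :
    boundary (m + 1) c ∈ K.chains m := by
  suffices h : K.chains (m + 1) ≤ (K.chains m).comap (boundary (m + 1)) from h hc
  refine K.chains_le fun s hs hcard => ?_
  rw [AddSubgroup.mem_comap, boundary, boundaryAux_single]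
  refine sum_mem fun v hv => ?_
  have hc' : (s.erase v).card = m + 1 := by rw [Finset.card_erase_of_mem hv, hcard]; rfl
  refine K.single_mem_chains ((K.isRelLowerSet_faces hs).2 (Finset.erase_subset _ _) ?_) hc'
  exact Finset.card_pos.1 (by omega)

theorem exists_splitting (K : FreeComplex ι) {m : ℕ} {c : Chain ι} (hc : c ∈ K.invChains m) :
    ∃ d ∈ K.chains m, c = d + K.act d := by
  classical
  obtain ⟨hc1, hc2⟩ := hc
  have hc1' : c ∈ K.chains m := hc1
  rw [mem_chains_iff] at hc1'
  have hinv : ∀ s, c (s.image K.invol) = c s := fun s => by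
    rw [← act_apply]; exact DFunLike.congr_fun hc2 s
  refine ⟨c.filter fun s => WellOrderingRel s (s.image K.invol), ?_, ?_⟩
  · rw [mem_chains_iff]
    intro s hs
    refine hc1' s fun h => hs ?_
    rw [Finsupp.filter_apply, h, ite_self]
  · ext1 s
    rw [Finsupp.add_apply, act_apply, Finsupp.filter_apply, Finsupp.filter_apply, K.image_image,
      hinv]
    by_cases hs : c s = 0
    · simp [hs]
    · have hne := K.image_ne s (hc1' s hs).1
      rcases trichotomous_of WellOrderingRel (s.image K.invol) s with h | h | h
      · rw [if_neg (asymm_of WellOrderingRel h), if_pos h, zero_add]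
      · exact absurd h hne
      · rw [if_pos h, if_neg (asymm_of WellOrderingRel h), add_zero]

theorem splitting_mem_invChains (K : FreeComplex ι) {m : ℕ} {d : Chain ι} (hd : d ∈ K.chains m) :
    d + K.act d ∈ K.invChains m := by
  refine ⟨add_mem hd (K.act_mem_chains hd), ?_⟩
  change K.act (d + K.act d) = d + K.act d
  rw [map_add, act_act, add_comm]

theorem boundary_act (K : FreeComplex ι) (m : ℕ) (c : Chain ι) :
    boundary m (K.act c) = K.act (boundary m c) := boundary_push _ _ _

theorem boundary_mem_cycles (K : FreeComplex ι) {m : ℕ} {c d : Chain ι}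
    (hc : c ∈ K.cycles (m + 1)) (hd : d ∈ K.chains (m + 1)) (h : c = d + K.act d) :
    boundary (m + 1) d ∈ K.cycles m := by
  refine ⟨⟨K.boundary_mem_chains hd, ?_⟩, boundary_boundary m d⟩
  change K.act (boundary (m + 1) d) = boundary (m + 1) d
  have hz : boundary (m + 1) c = 0 := hc.2
  rw [h, map_add, boundary_act] at hz
  rw [← ZModModule.sub_eq_add (boundary (m + 1) d), sub_eq_zero] at hz
  exact hz.symm

theorem parity_act (K : FreeComplex ι) (c : Chain ι) : parity (K.act c) = parity c := by
  suffices h : parity.comp K.act = parity from DFunLike.congr_fun h c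
  refine hom_ext fun s => ?_
  rw [AddMonoidHom.comp_apply, act, push_single_of_card (K.card_image s), parity_single,
    parity_single]

theorem parity_boundary_one (K : FreeComplex ι) {c : Chain ι} (hc : c ∈ K.chains 1) :
    parity (boundary 1 c) = 0 := by
  suffices h : K.chains 1 ≤ (parity.comp (boundary 1)).ker from h hc
  refine K.chains_le fun s _ hcard => ?_
  rw [AddMonoidHom.mem_ker, AddMonoidHom.comp_apply, boundary, boundaryAux_single, map_sum]
  simp only [parity_single, Finset.sum_const, hcard]
  rfl

/-- Two splittings of the same invariant chain differ by an invariant chain. -/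
theorem add_mem_invChains (K : FreeComplex ι) {m : ℕ} {d e : Chain ι} (hd : d ∈ K.chains m)
    (he : e ∈ K.chains m) (h : d + K.act d = e + K.act e) : d + e ∈ K.invChains m := by
  refine ⟨add_mem hd he, ?_⟩
  change K.act (d + e) = d + e
  rw [map_add]
  have h2 : K.act d = d + (e + K.act e) := by
    rw [← h, ← add_assoc, ZModModule.add_self, zero_add]
  rw [h2, add_assoc, add_assoc, ZModModule.add_self, add_zero]

/-- In dimension zero the index may be computed from any splitting. -/
theorem index_zero_eq (K : FreeComplex ι) {c d : Chain ι} (hd : d ∈ K.chains 0)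
    (h : c = d + K.act d) : K.index 0 c = parity d := by
  have hex : ∃ d ∈ K.chains 0, c = d + K.act d := ⟨d, hd, h⟩
  rw [index, dif_pos hex]
  obtain ⟨h1, h2⟩ := hex.choose_spec
  generalize hex.choose = e at h1 h2
  obtain ⟨g, _, hg⟩ := K.exists_splitting (K.add_mem_invChains hd h1 (h.symm.trans h2))
  have h3 : parity (d + e) = 0 := by rw [hg, map_add, parity_act, ZModModule.add_self]
  rw [map_add, ← ZModModule.sub_eq_add, sub_eq_zero] at h3
  exact h3.symm

theorem index_add_and_boundary (K : FreeComplex ι) (m : ℕ) :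
    (∀ c ∈ K.cycles m, ∀ c' ∈ K.cycles m, K.index m (c + c') = K.index m c + K.index m c') ∧
    (∀ e ∈ K.invChains (m + 1), K.index m (boundary (m + 1) e) = 0) ∧
    (∀ c ∈ K.cycles (m + 1), ∀ d ∈ K.chains (m + 1), c = d + K.act d →
      K.index (m + 1) c = K.index m (boundary (m + 1) d)) := by
  induction m with
  | zero =>
    have hadd : ∀ c ∈ K.cycles 0, ∀ c' ∈ K.cycles 0,
        K.index 0 (c + c') = K.index 0 c + K.index 0 c' := by
      intro c hc c' hc'
      obtain ⟨d, hd, h⟩ := K.exists_splitting hc.1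
      obtain ⟨d', hd', h'⟩ := K.exists_splitting hc'.1
      rw [K.index_zero_eq hd h, K.index_zero_eq hd' h', ← map_add]
      refine K.index_zero_eq (add_mem hd hd') ?_
      rw [h, h', map_add]
      abel
    have hbd : ∀ e ∈ K.invChains 1, K.index 0 (boundary 1 e) = 0 := by
      intro e he
      obtain ⟨g, hg, h⟩ := K.exists_splitting he
      rw [K.index_zero_eq (K.boundary_mem_chains hg)
        (by rw [h, map_add, boundary_act]), K.parity_boundary_one hg]
    refine ⟨hadd, hbd, ?_⟩
    intro c hc d hd h
    have hex : ∃ d ∈ K.chains 1, c = d + K.act d := ⟨d, hd, h⟩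
    obtain ⟨h1, h2⟩ := hex.choose_spec
    rw [show K.index (0 + 1) c = K.index 0 (boundary (0 + 1) hex.choose) from dif_pos hex]
    generalize hex.choose = e at h1 h2
    have h3 := hbd _ (K.add_mem_invChains hd h1 (h.symm.trans h2))
    rw [map_add, hadd _ (K.boundary_mem_cycles hc hd h) _ (K.boundary_mem_cycles hc h1 h2),
      ← ZModModule.sub_eq_add, sub_eq_zero] at h3
    exact h3.symm
  | succ m ih =>
    obtain ⟨ih1, ih2, ih3⟩ := ih
    have hadd : ∀ c ∈ K.cycles (m + 1), ∀ c' ∈ K.cycles (m + 1),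
        K.index (m + 1) (c + c') = K.index (m + 1) c + K.index (m + 1) c' := by
      intro c hc c' hc'
      obtain ⟨d, hd, h⟩ := K.exists_splitting hc.1
      obtain ⟨d', hd', h'⟩ := K.exists_splitting hc'.1
      rw [ih3 c hc d hd h, ih3 c' hc' d' hd' h',
        ← ih1 _ (K.boundary_mem_cycles hc hd h) _ (K.boundary_mem_cycles hc' hd' h'), ← map_add]
      refine ih3 _ (add_mem hc hc') _ (add_mem hd hd') ?_
      rw [h, h', map_add]
      abel
    have hbd : ∀ e ∈ K.invChains (m + 2), K.index (m + 1) (boundary (m + 2) e) = 0 := by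
      intro e he
      obtain ⟨g, hg, h⟩ := K.exists_splitting he
      have hs : boundary (m + 2) e = boundary (m + 2) g + K.act (boundary (m + 2) g) := by
        rw [h, map_add, boundary_act]
      have hg' := K.boundary_mem_chains hg
      have hcyc : boundary (m + 2) e ∈ K.cycles (m + 1) :=
        ⟨hs ▸ K.splitting_mem_invChains hg', boundary_boundary (m + 1) e⟩
      rw [ih3 _ hcyc _ hg' hs, boundary_boundary (m + 1) g]
      simpa using ih2 0 (zero_mem _)
    refine ⟨hadd, hbd, ?_⟩
    intro c hc d hd h
    have hex : ∃ d ∈ K.chains (m + 2), c = d + K.act d := ⟨d, hd, h⟩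
    obtain ⟨h1, h2⟩ := hex.choose_spec
    rw [show K.index (m + 1 + 1) c = K.index (m + 1) (boundary (m + 1 + 1) hex.choose) from
      dif_pos hex]
    generalize hex.choose = e at h1 h2
    have h3 := hbd _ (K.add_mem_invChains hd h1 (h.symm.trans h2))
    rw [map_add, hadd _ (K.boundary_mem_cycles hc hd h) _ (K.boundary_mem_cycles hc h1 h2),
      ← ZModModule.sub_eq_add, sub_eq_zero] at h3
    exact h3.symm

/-- In positive dimension the index of a cycle may be computed from any splitting. -/
theorem index_succ_eq (K : FreeComplex ι) {m : ℕ} {c d : Chain ι} (hc : c ∈ K.cycles (m + 1))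
    (hd : d ∈ K.chains (m + 1)) (h : c = d + K.act d) :
    K.index (m + 1) c = K.index m (boundary (m + 1) d) :=
  (K.index_add_and_boundary m).2.2 c hc d hd h

/-- The index as a homomorphism on invariant cycles. -/
noncomputable def indexCycles (K : FreeComplex ι) (m : ℕ) : K.cycles m →+ ZMod 2 :=
  AddMonoidHom.mk' (fun c : K.cycles m => K.index m c)
    fun c c' => (K.index_add_and_boundary m).1 c c.2 c' c'.2

/-- The homomorphism `ν : Hₘ(K, T) → ℤ/2` induced by the index of cycles. -/
noncomputable def homologyIndex (K : FreeComplex ι) (m : ℕ) : K.Homology m →+ ZMod 2 :=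
  QuotientAddGroup.lift _ (K.indexCycles m) <| by
    rintro ⟨c, hc⟩ hb
    obtain ⟨e, he, rfl⟩ := hb
    exact (K.index_add_and_boundary m).2.1 e he

/-- An equivariant simplicial map between complexes with free involutions. -/
structure Hom (K : FreeComplex ι) (L : FreeComplex κ) where
  toFun : ι → κ
  map_invol : ∀ i, toFun (K.invol i) = L.invol (toFun i)
  map_faces : ∀ s ∈ K.faces, s.image toFun ∈ L.faces

theorem Hom.act_push {K : FreeComplex ι} {L : FreeComplex κ} (f : Hom K L) (c : Chain ι) :
    L.act (push f.toFun c) = push f.toFun (K.act c) := by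
  rw [act, act, push_comp, push_comp]
  congr 2
  funext i
  exact (f.map_invol i).symm

theorem Hom.push_mem_chains {K : FreeComplex ι} {L : FreeComplex κ} (f : Hom K L) {m : ℕ}
    {c : Chain ι} (hc : c ∈ K.chains m) : push f.toFun c ∈ L.chains m := by
  suffices h : K.chains m ≤ (L.chains m).comap (push f.toFun) from h hc
  refine K.chains_le fun s hs hcard => ?_
  rw [AddSubgroup.mem_comap, push_single]
  split_ifs with h
  · exact L.single_mem_chains (f.map_faces s hs) (h.trans hcard)
  · exact zero_mem _

theorem Hom.push_mem_invChains {K : FreeComplex ι} {L : FreeComplex κ} (f : Hom K L) {m : ℕ}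
    {c : Chain ι} (hc : c ∈ K.invChains m) : push f.toFun c ∈ L.invChains m := by
  refine ⟨f.push_mem_chains hc.1, ?_⟩
  have h : K.act c = c := hc.2
  change L.act (push f.toFun c) = push f.toFun c
  rw [f.act_push, h]

theorem Hom.push_mem_cycles {K : FreeComplex ι} {L : FreeComplex κ} (f : Hom K L) {m : ℕ}
    {c : Chain ι} (hc : c ∈ K.cycles m) : push f.toFun c ∈ L.cycles m := by
  refine ⟨f.push_mem_invChains hc.1, ?_⟩
  have h : boundary m c = 0 := hc.2
  change boundary m (push f.toFun c) = 0
  rw [boundary_push, h, map_zero]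

/-- The map induced on invariant cycles by an equivariant simplicial map. -/
noncomputable def Hom.cyclesMap {K : FreeComplex ι} {L : FreeComplex κ} (f : Hom K L) (m : ℕ) :
    K.cycles m →+ L.cycles m :=
  ((push f.toFun).comp (K.cycles m).subtype).codRestrict (L.cycles m)
    fun c => f.push_mem_cycles c.2

/-- The map induced on equivariant homology by an equivariant simplicial map. -/
noncomputable def Hom.homologyMap {K : FreeComplex ι} {L : FreeComplex κ} (f : Hom K L) (m : ℕ) :
    K.Homology m →+ L.Homology m :=
  QuotientAddGroup.map _ _ (f.cyclesMap m) <| by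
    rintro ⟨c, hc⟩ hb
    obtain ⟨e, he, rfl⟩ := hb
    exact ⟨push f.toFun e, f.push_mem_invChains he, boundary_push _ _ _⟩

/-- The index is preserved by equivariant simplicial maps. -/
theorem Hom.index_push {K : FreeComplex ι} {L : FreeComplex κ} (f : Hom K L) (m : ℕ)
    {c : Chain ι} (hc : c ∈ K.cycles m) : L.index m (push f.toFun c) = K.index m c := by
  induction m generalizing c with
  | zero =>
    obtain ⟨d, hd, h⟩ := K.exists_splitting hc.1
    rw [K.index_zero_eq hd h, L.index_zero_eq (f.push_mem_chains hd)
      (by rw [h, map_add, f.act_push])]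
    suffices h : K.chains 0 ≤ AddMonoidHom.eqLocus (parity.comp (push f.toFun)) parity from h hd
    refine K.chains_le fun s _ hcard => ?_
    obtain ⟨i, rfl⟩ := Finset.card_eq_one.1 hcard
    change parity (push f.toFun (Finsupp.single {i} 1)) = parity (Finsupp.single {i} 1)
    rw [push_single_of_card (by simp), parity_single, parity_single]
  | succ m ih =>
    obtain ⟨d, hd, h⟩ := K.exists_splitting hc.1
    rw [K.index_succ_eq hc hd h, L.index_succ_eq (f.push_mem_cycles hc) (f.push_mem_chains hd)
      (by rw [h, map_add, f.act_push]), boundary_push, ih (K.boundary_mem_cycles hc hd h)]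

theorem Hom.homologyIndex_map {K : FreeComplex ι} {L : FreeComplex κ} (f : Hom K L) (m : ℕ)
    (x : K.Homology m) : L.homologyIndex m (f.homologyMap m x) = K.homologyIndex m x := by
  obtain ⟨c, rfl⟩ := QuotientAddGroup.mk_surjective x
  exact f.index_push m c.2

end FreeComplex

/-! ### Spaces with a free involution and their Čech–Smith homology -/

section Spaces

/-- `(X, T)` is a `T`-space: `X` is compact Hausdorff and `T` is a fixed-point free (continuous)
involution. -/
structure IsTSpace (X : Type*) [TopologicalSpace X] (T : X → X) : Prop where
  compact : CompactSpace X
  hausdorff : T2Space X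
  continuous : Continuous T
  involutive : ∀ x, T (T x) = x
  fixed_point_free : ∀ x, T x ≠ x

/-- A finite open cover of `X` that is permuted freely by the involution `T` and none of whose
members meets its image under `T`. -/
structure InvCover (X : Type*) [TopologicalSpace X] (T : X → X) where
  ι : Type
  finite_index : Finite ι
  U : ι → Set X
  isOpen : ∀ i, IsOpen (U i)
  covers : ∀ x, ∃ i, x ∈ U i
  invol : ι → ι
  invol_invol : ∀ i, invol (invol i) = i
  invol_ne : ∀ i, invol i ≠ i
  U_invol : ∀ i, U (invol i) = T ⁻¹' U i
  disjoint : ∀ i, Disjoint (U i) (U (invol i))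

variable {X : Type*} [TopologicalSpace X] {T : X → X}

noncomputable instance (C : InvCover X T) : DecidableEq C.ι := Classical.decEq _

/-- The nerve of an invariant cover, with the induced involution. -/
noncomputable def InvCover.nerve (C : InvCover X T) : FreeComplex C.ι where
  faces := {s | s.Nonempty ∧ ∃ x, ∀ i ∈ s, x ∈ C.U i}
  isRelLowerSet_faces := by
    rintro s ⟨hs, x, hx⟩
    exact ⟨hs, fun t hts ht => ⟨ht, x, fun i hi => hx i (hts hi)⟩⟩
  invol := C.invol
  invol_invol := C.invol_invol
  image_mem := by
    rintro s ⟨hs, x, hx⟩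
    obtain ⟨i, hi⟩ := hs
    refine ⟨⟨_, Finset.mem_image_of_mem _ hi⟩, T x, ?_⟩
    intro j hj
    obtain ⟨k, hk, rfl⟩ := Finset.mem_image.1 hj
    have h := hx k hk
    rw [← C.invol_invol k, C.U_invol] at h
    exact h
  image_ne := by
    rintro s ⟨⟨i, hi⟩, x, hx⟩ heq
    have hi' : C.invol i ∈ s := by
      have h := Finset.mem_image_of_mem C.invol hi
      rwa [heq] at h
    exact Set.disjoint_left.1 (C.disjoint i) (hx i hi) (hx _ hi')

/-- An equivariant refinement projection: `D` refines `C` through an equivariant map of indices. -/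
structure Refinement (D C : InvCover X T) where
  toFun : D.ι → C.ι
  map_invol : ∀ i, toFun (D.invol i) = C.invol (toFun i)
  subset : ∀ i, D.U i ⊆ C.U (toFun i)

/-- The simplicial map of nerves given by a refinement projection. -/
noncomputable def Refinement.nerveMap {D C : InvCover X T} (r : Refinement D C) :
    FreeComplex.Hom D.nerve C.nerve where
  toFun := r.toFun
  map_invol := r.map_invol
  map_faces := by
    rintro s ⟨hs, x, hx⟩
    refine ⟨hs.image _, x, fun j hj => ?_⟩
    obtain ⟨i, hi, rfl⟩ := Finset.mem_image.1 hj
    exact r.subset i (hx i hi)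

/-- The `m`-th (Čech–Smith) `T`-homology group of `(X, T)`: the inverse limit of the equivariant
homology groups of the nerves of the invariant covers, along the refinement projections. -/
noncomputable def cechHomology (X : Type*) [TopologicalSpace X] (T : X → X) (m : ℕ) :
    AddSubgroup (∀ C : InvCover X T, C.nerve.Homology m) where
  carrier := {x | ∀ (D C : InvCover X T) (r : Refinement D C),
    r.nerveMap.homologyMap m (x D) = x C}
  add_mem' := by
    intro x y hx hy D C r
    rw [Pi.add_apply, Pi.add_apply, map_add, hx D C r, hy D C r]
  zero_mem' := by
    intro D C r
    rw [Pi.zero_apply, Pi.zero_apply, map_zero]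
  neg_mem' := by
    intro x hx D C r
    rw [Pi.neg_apply, Pi.neg_apply, map_neg, hx D C r]

open Classical in
/-- The index `ν : Hₘ(X, T) → ℤ/2`: the common value of the indices of the components of an element
of the inverse limit, see `cechIndex_eq`. -/
noncomputable def cechIndex (m : ℕ) (x : cechHomology X T m) : ZMod 2 :=
  if ∀ C : InvCover X T, C.nerve.homologyIndex m (x.1 C) = 1 then 1 else 0

/-- The common refinement of two invariant covers. -/
noncomputable def InvCover.inf (C D : InvCover X T) : InvCover X T where
  ι := C.ι × D.ι
  finite_index := by
    have := C.finite_index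
    have := D.finite_index
    infer_instance
  U p := C.U p.1 ∩ D.U p.2
  isOpen p := (C.isOpen p.1).inter (D.isOpen p.2)
  covers x := by
    obtain ⟨i, hi⟩ := C.covers x
    obtain ⟨j, hj⟩ := D.covers x
    exact ⟨(i, j), hi, hj⟩
  invol p := (C.invol p.1, D.invol p.2)
  invol_invol p := by simp [C.invol_invol, D.invol_invol]
  invol_ne p h := C.invol_ne p.1 (congrArg Prod.fst h)
  U_invol p := by simp only [C.U_invol, D.U_invol, Set.preimage_inter]
  disjoint p := (C.disjoint p.1).mono Set.inter_subset_left Set.inter_subset_left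

/-- The indices of the components of an element of the inverse limit all agree with its index. -/
theorem cechIndex_eq (m : ℕ) (x : cechHomology X T m) (C : InvCover X T) :
    cechIndex m x = C.nerve.homologyIndex m (x.1 C) := by
  have hconst : ∀ D : InvCover X T,
      D.nerve.homologyIndex m (x.1 D) = C.nerve.homologyIndex m (x.1 C) := by
    intro D
    let r : Refinement (C.inf D) C := ⟨Prod.fst, fun _ => rfl, fun _ => Set.inter_subset_left⟩
    let r' : Refinement (C.inf D) D := ⟨Prod.snd, fun _ => rfl, fun _ => Set.inter_subset_right⟩
    rw [← x.2 _ _ r, ← x.2 _ _ r', FreeComplex.Hom.homologyIndex_map,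
      FreeComplex.Hom.homologyIndex_map]
  unfold cechIndex
  split_ifs with h
  · exact (h C).symm
  · rcases eq_zero_or_eq_one (C.nerve.homologyIndex m (x.1 C)) with h0 | h1
    · exact h0.symm
    · exact absurd (fun D => (hconst D).trans h1) h

/-- Every `T`-space has an invariant cover. -/
theorem IsTSpace.nonempty_invCover (h : IsTSpace X T) : Nonempty (InvCover X T) := by
  have := h.compact
  have := h.hausdorff
  have hloc : ∀ x : X, ∃ V : Set X, IsOpen V ∧ x ∈ V ∧ Disjoint V (T ⁻¹' V) := by
    intro x
    obtain ⟨A, B, hA, hB, hxA, hxB, hAB⟩ := t2_separation (h.fixed_point_free x).symm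
    refine ⟨A ∩ T ⁻¹' B, hA.inter (hB.preimage h.continuous), ⟨hxA, hxB⟩, ?_⟩
    exact Set.disjoint_left.2 fun y hy hy' => Set.disjoint_left.1 hAB hy'.1 hy.2
  choose V hVo hxV hVd using hloc
  obtain ⟨t, ht⟩ := isCompact_univ.elim_finite_subcover V hVo
    fun x _ => Set.mem_iUnion.2 ⟨x, hxV x⟩
  let e := t.equivFin
  refine ⟨⟨Fin t.card × Bool, inferInstance,
    fun p => if p.2 then V (e.symm p.1) else T ⁻¹' V (e.symm p.1), ?_, ?_,
    fun p => (p.1, !p.2), ?_, ?_, ?_, ?_⟩⟩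
  · rintro ⟨i, b⟩
    cases b
    · simpa using (hVo _).preimage h.continuous
    · simpa using hVo _
  · intro x
    obtain ⟨y, hy, hxy⟩ := Set.mem_iUnion₂.1 (ht (Set.mem_univ x))
    exact ⟨(e ⟨y, hy⟩, true), by simpa using hxy⟩
  · rintro ⟨i, b⟩
    simp
  · rintro ⟨i, b⟩
    simp
  · rintro ⟨i, b⟩
    have hTT : ∀ W : Set X, T ⁻¹' (T ⁻¹' W) = W := by
      intro W
      ext y
      simp [h.involutive]
    cases b <;> simp [hTT]
  · rintro ⟨i, b⟩
    cases b
    · simpa using (hVd _).symm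
    · simpa using hVd _

/-- The Yang index of `(X, T)`: the largest `m` such that `ν` is not zero on `Hₘ(X, T)`, in
`ℕ ∪ {∞}`. -/
noncomputable def yangIndex (X : Type*) [TopologicalSpace X] (T : X → X) : ℕ∞ :=
  sSup {a : ℕ∞ | ∃ m : ℕ, a = m ∧ ∃ x : cechHomology X T m, cechIndex m x ≠ 0}

/-- There exists an equivariant (continuous) map `(X, T) → (Y, S)`. -/
def ExistsEquivariant {X Y : Type*} [TopologicalSpace X] [TopologicalSpace Y]
    (T : X → X) (S : Y → Y) : Prop :=
  ∃ f : X → Y, Continuous f ∧ ∀ x, f (T x) = S (f x)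

/-- The unit sphere `Sⁿ` in `ℝⁿ⁺¹`. -/
abbrev Sph (n : ℕ) : Type := Metric.sphere (0 : EuclideanSpace ℝ (Fin (n + 1))) 1

/-- The antipodal map of `Sⁿ`. -/
noncomputable def antipode (n : ℕ) : Sph n → Sph n := fun x => -x

/-- The Conner–Floyd index: the maximum, in `ℕ ∪ {∞}`, of the `n` such that there is an equivariant
map `Sⁿ → X`. -/
noncomputable def cfIndex (X : Type*) [TopologicalSpace X] (T : X → X) : ℕ∞ :=
  sSup {a : ℕ∞ | ∃ n : ℕ, a = n ∧ ExistsEquivariant (antipode n) T}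

/-- The Conner–Floyd coindex: the minimum, in `ℕ ∪ {∞}`, of the `n` such that there is an
equivariant map `X → Sⁿ`. -/
noncomputable def cfCoindex (X : Type*) [TopologicalSpace X] (T : X → X) : ℕ∞ :=
  sInf {a : ℕ∞ | ∃ n : ℕ, a = n ∧ ExistsEquivariant T (antipode n)}

end Spaces

/-! ### Stiefel manifolds -/

/-- The real Stiefel manifold of orthonormal `k`-tuples of vectors in `ℝⁿ`. -/
abbrev Stiefel (n k : ℕ) : Type :=
  {v : Fin k → EuclideanSpace ℝ (Fin n) // Orthonormal ℝ v}

/-- The involution that negates the last vector of an orthonormal tuple. -/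
noncomputable def stiefelInvol (n k : ℕ) : Stiefel n k → Stiefel n k := fun V =>
  ⟨fun i => if (i : ℕ) + 1 = k then -V.1 i else V.1 i, by
    have hV := V.2
    rw [orthonormal_iff_ite] at hV ⊢
    intro i j
    have h := hV i j
    by_cases hij : i = j
    · subst hij
      rw [if_pos rfl] at h ⊢
      split_ifs
      · rw [inner_neg_neg, h]
      · rw [h]
    · rw [if_neg hij] at h ⊢
      split_ifs <;> simp [h]⟩

theorem stiefel_isTSpace {n k : ℕ} (hk : 1 ≤ k) : IsTSpace (Stiefel n k) (stiefelInvol n k) where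
  compact := by
    suffices hc : IsCompact {v : Fin k → EuclideanSpace ℝ (Fin n) | Orthonormal ℝ v} from
      isCompact_iff_compactSpace.1 hc
    refine Metric.isCompact_of_isClosed_isBounded ?_ ?_
    · have : {v : Fin k → EuclideanSpace ℝ (Fin n) | Orthonormal ℝ v} =
          ⋂ i, ⋂ j, {v | inner ℝ (v i) (v j) = if i = j then (1 : ℝ) else 0} := by
        ext v
        simp [orthonormal_iff_ite]
      change IsClosed {v : Fin k → EuclideanSpace ℝ (Fin n) | Orthonormal ℝ v}
      rw [this]
      refine isClosed_iInter fun i => isClosed_iInter fun j => isClosed_eq ?_ continuous_const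
      exact (continuous_apply i).inner (continuous_apply j)
    · refine (Metric.isBounded_closedBall (x := 0) (r := 1)).subset fun v hv => ?_
      rw [mem_closedBall_zero_iff]
      exact (pi_norm_le_iff_of_nonneg zero_le_one).2 fun i => (hv.1 i).le
  hausdorff := inferInstance
  continuous := by
    refine Continuous.subtype_mk (continuous_pi fun i => ?_) _
    have h : Continuous fun V : Stiefel n k => V.1 i :=
      (continuous_apply i).comp continuous_subtype_val
    split_ifs
    · exact h.neg
    · exact h
  involutive V := by
    refine Subtype.ext (funext fun i => ?_)
    simp only [stiefelInvol]
    split_ifs <;> simp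
  fixed_point_free V h := by
    have hlt : k - 1 < k := by omega
    have h1 := congrFun (congrArg Subtype.val h) ⟨k - 1, hlt⟩
    have h2 : k - 1 + 1 = k := by omega
    simp only [stiefelInvol, h2, if_true] at h1
    have h3 : V.1 ⟨k - 1, hlt⟩ = 0 := by
      have h4 := eq_neg_iff_add_eq_zero.1 h1.symm
      rwa [← two_smul ℝ, smul_eq_zero_iff_right two_ne_zero] at h4
    exact V.2.ne_zero _ h3

/-- The Conner–Floyd index of `St(n,k)`. -/
noncomputable def indSt (n k : ℕ) : ℕ∞ := cfIndex (Stiefel n k) (stiefelInvol n k)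

/-- The Yang index of `St(n,k)`. -/
noncomputable def yangSt (n k : ℕ) : ℕ∞ := yangIndex (Stiefel n k) (stiefelInvol n k)

/-- The coindex of `St(n,k)`. -/
noncomputable def coindSt (n k : ℕ) : ℕ∞ := cfCoindex (Stiefel n k) (stiefelInvol n k)

end ZTwo

/-! An equivariant map `(X, T) → (Y, S)` can only increase the three indices: it can be composed
with equivariant maps `Sᵐ → X` and `Y → Sᵐ`, and it pushes Čech–Smith homology forward without
changing the index of a class. For the last point, an invariant cover `C` of `Y` pulls back to an
invariant cover of `X` with the same index set, whose nerve is a subcomplex of the nerve of `C`; the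
component at `C` of the image of a class is the image of its component at the pulled back cover
(`InvCover.nerveInclusion`, `pushforward`, `cechIndex_pushforward`). This gives
`yangIndex_le_of_existsEquivariant`.

The monotonicity of the indices of Stiefel manifolds then comes from three equivariant maps:
forgetting the first vector, `St(n,k+1) → St(n,k)`; including `ℝⁿ` as a hyperplane of `ℝⁿ⁺¹`,
`St(n,k) → St(n+1,k)`; and including `ℝⁿ` in this way and putting the unit vector normal to the
hyperplane in front of the tuple, `St(n,k) → St(n+1,k+1)`. None of them touches the last vector,
apart from applying the linear inclusion to it. -/

namespace ZTwo

theorem FreeComplex.Hom.homologyMap_comm {ι κ κ' ξ : Type*} [DecidableEq ι] [DecidableEq κ]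
    [DecidableEq κ'] [DecidableEq ξ] {K : FreeComplex ι} {L : FreeComplex κ} {L' : FreeComplex κ'}
    {M : FreeComplex ξ} {g : Hom L M} {f : Hom K L} {g' : Hom L' M} {f' : Hom K L'}
    (h : g.toFun ∘ f.toFun = g'.toFun ∘ f'.toFun) (m : ℕ) (x : K.Homology m) :
    g.homologyMap m (f.homologyMap m x) = g'.homologyMap m (f'.homologyMap m x) := by
  obtain ⟨c, rfl⟩ := QuotientAddGroup.mk_surjective x
  refine congrArg QuotientAddGroup.mk (Subtype.ext ?_)
  change push g.toFun (push f.toFun c.1) = push g'.toFun (push f'.toFun c.1)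
  rw [push_comp, push_comp, h]

section Equivariant

variable {X Y Z : Type*} [TopologicalSpace X] [TopologicalSpace Y] [TopologicalSpace Z]
  {T : X → X} {S : Y → Y} {R : Z → Z}

theorem ExistsEquivariant.refl (T : X → X) : ExistsEquivariant T T :=
  ⟨id, continuous_id, fun _ => rfl⟩

theorem ExistsEquivariant.trans (h : ExistsEquivariant T S) (h' : ExistsEquivariant S R) :
    ExistsEquivariant T R := by
  obtain ⟨f, hf, hfT⟩ := h
  obtain ⟨g, hg, hgS⟩ := h'
  exact ⟨g ∘ f, hg.comp hf, fun x => by simp only [Function.comp_apply, hfT, hgS]⟩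

theorem cfIndex_le_of_existsEquivariant (h : ExistsEquivariant T S) :
    cfIndex X T ≤ cfIndex Y S := by
  refine sSup_le_sSup ?_
  rintro a ⟨m, rfl, hm⟩
  exact ⟨m, rfl, hm.trans h⟩

theorem cfCoindex_le_of_existsEquivariant (h : ExistsEquivariant T S) :
    cfCoindex X T ≤ cfCoindex Y S := by
  refine sInf_le_sInf ?_
  rintro a ⟨m, rfl, hm⟩
  exact ⟨m, rfl, h.trans hm⟩

/-- The preimage of an invariant cover under an equivariant map, with the same index set; some of
its members may be empty. -/
def InvCover.pullback {f : X → Y} (hf : Continuous f) (hfT : ∀ x, f (T x) = S (f x))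
    (C : InvCover Y S) : InvCover X T where
  ι := C.ι
  finite_index := C.finite_index
  U i := f ⁻¹' C.U i
  isOpen i := (C.isOpen i).preimage hf
  covers x := C.covers (f x)
  invol := C.invol
  invol_invol := C.invol_invol
  invol_ne := C.invol_ne
  U_invol i := by
    ext x
    simp only [C.U_invol, Set.mem_preimage, hfT]
  disjoint i := (C.disjoint i).preimage f

/-- The inclusion of the nerve of the pulled back cover in the nerve of the cover. -/
noncomputable def InvCover.nerveInclusion {f : X → Y} (hf : Continuous f)
    (hfT : ∀ x, f (T x) = S (f x)) (C : InvCover Y S) :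
    FreeComplex.Hom (C.pullback hf hfT).nerve C.nerve where
  toFun := id
  map_invol _ := rfl
  map_faces := by
    rintro s ⟨hs, x, hx⟩
    refine ⟨hs.image _, f x, fun j hj => ?_⟩
    obtain ⟨i, hi, rfl⟩ := Finset.mem_image.1 hj
    exact hx i hi

/-- A refinement projection between covers of `Y` is also one between the pulled back covers. -/
def Refinement.pullback {f : X → Y} (hf : Continuous f) (hfT : ∀ x, f (T x) = S (f x))
    {D C : InvCover Y S} (r : Refinement D C) :
    Refinement (D.pullback hf hfT) (C.pullback hf hfT) where
  toFun := r.toFun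
  map_invol := r.map_invol
  subset i := Set.preimage_mono (r.subset i)

/-- The map `Hₘ(X, T) → Hₘ(Y, S)` induced by an equivariant map. -/
noncomputable def pushforward {f : X → Y} (hf : Continuous f) (hfT : ∀ x, f (T x) = S (f x))
    (m : ℕ) (x : cechHomology X T m) : cechHomology Y S m :=
  ⟨fun C => (C.nerveInclusion hf hfT).homologyMap m (x.1 (C.pullback hf hfT)), by
    intro D C r
    beta_reduce
    rw [← x.2 _ _ (r.pullback hf hfT)]
    exact FreeComplex.Hom.homologyMap_comm (g := r.nerveMap) (f := D.nerveInclusion hf hfT)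
      (g' := C.nerveInclusion hf hfT) (f' := (r.pullback hf hfT).nerveMap) rfl m _⟩

theorem cechIndex_pushforward {f : X → Y} (hf : Continuous f) (hfT : ∀ x, f (T x) = S (f x))
    (hY : IsTSpace Y S) (m : ℕ) (x : cechHomology X T m) :
    cechIndex m (pushforward hf hfT m x) = cechIndex m x := by
  obtain ⟨C⟩ := hY.nonempty_invCover
  rw [cechIndex_eq m _ C, cechIndex_eq m x (C.pullback hf hfT)]
  exact FreeComplex.Hom.homologyIndex_map _ m _

theorem yangIndex_le_of_existsEquivariant (hY : IsTSpace Y S) (h : ExistsEquivariant T S) :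
    yangIndex X T ≤ yangIndex Y S := by
  obtain ⟨f, hf, hfT⟩ := h
  refine sSup_le_sSup ?_
  rintro a ⟨m, rfl, x, hx⟩
  exact ⟨m, rfl, pushforward hf hfT m x, by rwa [cechIndex_pushforward hf hfT hY]⟩

end Equivariant

theorem stiefel_existsEquivariant_tail (n k : ℕ) :
    ExistsEquivariant (stiefelInvol n (k + 1)) (stiefelInvol n k) := by
  refine ⟨fun V => ⟨fun i => V.1 i.succ, V.2.comp _ (Fin.succ_injective k)⟩, ?_, fun V => ?_⟩
  · exact Continuous.subtype_mk
      (continuous_pi fun i => (continuous_apply i.succ).comp continuous_subtype_val) _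
  · refine Subtype.ext (funext fun i => ?_)
    simp [stiefelInvol]

/-- The inclusion of `ℝⁿ` in `ℝⁿ⁺¹` as the hyperplane where the first coordinate vanishes. -/
noncomputable def hyperplaneInclusion (n : ℕ) :
    EuclideanSpace ℝ (Fin n) →ₗᵢ[ℝ] EuclideanSpace ℝ (Fin (n + 1)) where
  toFun x := WithLp.toLp 2 (Fin.cons 0 x.ofLp)
  map_add' x y := by
    ext i
    refine Fin.cases ?_ (fun j => ?_) i <;> simp
  map_smul' a x := by
    ext i
    refine Fin.cases ?_ (fun j => ?_) i <;> simp
  norm_map' x := by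
    simp [EuclideanSpace.norm_eq, Fin.sum_univ_succ]

theorem inner_single_zero_hyperplaneInclusion (n : ℕ) (x : EuclideanSpace ℝ (Fin n)) :
    inner ℝ (EuclideanSpace.single 0 1) (hyperplaneInclusion n x) = 0 := by
  simp [hyperplaneInclusion, EuclideanSpace.inner_single_left]

theorem stiefel_existsEquivariant_hyperplaneInclusion (n k : ℕ) :
    ExistsEquivariant (stiefelInvol n k) (stiefelInvol (n + 1) k) := by
  refine ⟨fun V => ⟨fun i => hyperplaneInclusion n (V.1 i),
    V.2.comp_linearIsometry (hyperplaneInclusion n)⟩, ?_, fun V => ?_⟩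
  · exact Continuous.subtype_mk (continuous_pi fun i => (hyperplaneInclusion n).continuous.comp
      ((continuous_apply i).comp continuous_subtype_val)) _
  · refine Subtype.ext (funext fun i => ?_)
    simp only [stiefelInvol]
    split_ifs <;> simp

/-- For `k = 0` the new vector would be the last one, which the involution of `St(n+1,1)` negates. -/
theorem stiefel_existsEquivariant_cons (n : ℕ) {k : ℕ} (hk : 1 ≤ k) :
    ExistsEquivariant (stiefelInvol n k) (stiefelInvol (n + 1) (k + 1)) := by
  refine ⟨fun V => ⟨Fin.cons (EuclideanSpace.single 0 1) fun i => hyperplaneInclusion n (V.1 i),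
    ?_⟩, ?_, fun V => ?_⟩
  · have hV := V.2.comp_linearIsometry (hyperplaneInclusion n)
    rw [orthonormal_iff_ite] at hV ⊢
    intro i j
    refine Fin.cases ?_ (fun i => ?_) i <;> refine Fin.cases ?_ (fun j => ?_) j
    · simp
    · simp only [Fin.cons_zero, Fin.cons_succ, inner_single_zero_hyperplaneInclusion,
        (Fin.succ_ne_zero j).symm, if_false]
    · rw [real_inner_comm]
      simp only [Fin.cons_zero, Fin.cons_succ, inner_single_zero_hyperplaneInclusion,
        Fin.succ_ne_zero i, if_false]
    · simpa using hV i j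
  · refine Continuous.subtype_mk (continuous_pi fun i => ?_) _
    refine Fin.cases ?_ (fun i => ?_) i
    · exact continuous_const
    · exact (hyperplaneInclusion n).continuous.comp
        ((continuous_apply i).comp continuous_subtype_val)
  · refine Subtype.ext (funext fun i => ?_)
    refine Fin.cases ?_ (fun i => ?_) i
    · simp [stiefelInvol, show ¬ 0 = k by omega]
    · simp only [stiefelInvol, Fin.cons_succ, Fin.val_succ, Nat.add_right_cancel_iff]
      split_ifs <;> simp

theorem stiefel_indices_le_of_existsEquivariant {n k n' k' : ℕ} (hk' : 1 ≤ k')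
    (h : ExistsEquivariant (stiefelInvol n k) (stiefelInvol n' k')) :
    indSt n k ≤ indSt n' k' ∧ yangSt n k ≤ yangSt n' k' ∧ coindSt n k ≤ coindSt n' k' :=
  ⟨cfIndex_le_of_existsEquivariant h,
    yangIndex_le_of_existsEquivariant (stiefel_isTSpace hk') h,
    cfCoindex_le_of_existsEquivariant h⟩

end ZTwo

theorem proposition4p1 :
    (∀ n k k' : ℕ, 1 ≤ k → k ≤ k' → k' ≤ n →
      ZTwo.indSt n k' ≤ ZTwo.indSt n k ∧
      ZTwo.yangSt n k' ≤ ZTwo.yangSt n k ∧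
      ZTwo.coindSt n k' ≤ ZTwo.coindSt n k) ∧
    (∀ k n n' : ℕ, 1 ≤ k → k ≤ n → n ≤ n' →
      ZTwo.indSt n k ≤ ZTwo.indSt n' k ∧
      ZTwo.yangSt n k ≤ ZTwo.yangSt n' k ∧
      ZTwo.coindSt n k ≤ ZTwo.coindSt n' k) ∧
    (∀ n k ℓ ℓ' : ℕ, 1 ≤ k → k ≤ n → ℓ ≤ ℓ' →
      ZTwo.indSt (n + ℓ) (k + ℓ) ≤ ZTwo.indSt (n + ℓ') (k + ℓ') ∧
      ZTwo.yangSt (n + ℓ) (k + ℓ) ≤ ZTwo.yangSt (n + ℓ') (k + ℓ') ∧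
      ZTwo.coindSt (n + ℓ) (k + ℓ) ≤ ZTwo.coindSt (n + ℓ') (k + ℓ')) := by
  refine ⟨fun n k k' hk hkk' _ => ?_, fun k n n' hk _ hnn' => ?_, fun n k ℓ ℓ' hk _ hℓ => ?_⟩
  · refine ZTwo.stiefel_indices_le_of_existsEquivariant hk ?_
    induction k', hkk' using Nat.le_induction with
    | base => exact .refl _
    | succ j _ ih => exact (ZTwo.stiefel_existsEquivariant_tail n j).trans (ih (by omega))
  · refine ZTwo.stiefel_indices_le_of_existsEquivariant hk ?_
    induction n', hnn' using Nat.le_induction with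
    | base => exact .refl _
    | succ j _ ih => exact ih.trans (ZTwo.stiefel_existsEquivariant_hyperplaneInclusion j k)
  · refine ZTwo.stiefel_indices_le_of_existsEquivariant (by omega) ?_
    induction ℓ', hℓ using Nat.le_induction with
    | base => exact .refl _
    | succ j _ ih => exact ih.trans (ZTwo.stiefel_existsEquivariant_cons (n + j) (by omega))
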